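/- A \emph{stem extension} of a finite group $G$ is a group $E$ with a surjective homomorphism $\pi:E\to G$ such that $\ker\pi\subseteq Z(E)\cap[E,E]$. The orders of the stem extensions of $G$ are bounded, and a stem extension of maximal order is called a \emph{Schur cover} of $G$. Given a Schur cover $\pi:\tilde G\to G$, the \emph{deep commuting graph} $\Delta_D(G)$ is the simple graph with vertex set $G$ in which two distinct elements $x,y$ are adjacent if and only if their preimages under $\pi$ commute in $\tilde G$. For a graph $\Gamma$, the \emph{reduced graph} $\Gamma^*$ is the subgraph induced on the set of those vertices that are not dominant, where a vertex is dominant if it is adjacent to every other vertex. Let $n\ge 8$ be an integer and let $A_n$ be the alternating group of degree $n$. For every choice of the Schur cover of $A_n$, the following hold. The graph $\Delta_D(A_n)^*$ is connected if and only if none of $n$, $n-1$, $n-2$ is prime. Moreover: (i) if, among $n,n-1,n-2$, only $n$ is prime, then $\Delta_D(A_n)^*$ has exactly $(n-2)!+1$ connected components; (ii) if only $n-1$ is prime, then $\Delta_D(A_n)^*$ has exactly $n\,(n-3)!+1$ connected components; (iii) if only $n-2$ is prime, then $\Delta_D(A_n)^*$ has exactly $\frac{n(n-1)(n-4)!}{2}+1$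 connected components; (iv) if both $n$ and $n-2$ are prime, then $\Delta_D(A_n)^*$ has exactly $(n-2)!+\frac{n(n-1)(n-4)!}{2}+1$ connected components. -/

import Mathlib

universe u v

/-- `π : E →* G` exhibits `E` as a stem extension of `G`: `π` is onto and its kernel lies in
`Z(E) ∩ [E, E]`. -/
structure IsStemExtension {G : Type u} {E : Type v} [Group G] [Group E] (π : E →* G) : Prop where
  surjective : Function.Surjective π
  ker_le_center : π.ker ≤ Subgroup.center E
  ker_le_commutator : π.ker ≤ commutator E

/-- `π : E →* G` exhibits `E` as a Schur cover of the finite group `G`: a finite stem extension of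
`G` whose order is maximal among all stem extensions of `G`. -/
structure IsSchurCover {G : Type u} {E : Type v} [Group G] [Group E] (π : E →* G) : Prop where
  finite : Finite E
  isStem : IsStemExtension π
  card_le : ∀ (H : Type v) [Group H] [Finite H] (ρ : H →* G),
    IsStemExtension ρ → Nat.card H ≤ Nat.card E

/-- The deep commuting graph of `G`, computed in the extension `π : E →* G`: distinct `x`, `y` are
adjacent iff their preimages under `π` commute in `E`. It is used for Schur covers `π`. -/
def deepCommutingGraph {G : Type u} {E : Type v} [Group G] [Group E] (π : E →* G) :
    SimpleGraph G where
  Adj x y := x ≠ y ∧ ∀ a b : E, π a = x → π b = y → Commute a b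
  symm := ⟨fun _ _ h => ⟨h.1.symm, fun a b ha hb => (h.2 b a hb ha).symm⟩⟩
  loopless := ⟨fun _ h => h.1 rfl⟩

/-- The reduced graph: the subgraph induced on the vertices that are not dominant (a vertex is
dominant if it is adjacent to every other vertex). -/
def reducedGraph {V : Type u} (Γ : SimpleGraph V) :
    SimpleGraph ((Γ.universalVerts)ᶜ : Set V) :=
  Γ.induce (Γ.universalVerts)ᶜ

/-- The orders of the finite stem extensions of a finite group are bounded. -/
theorem IsStemExtension.card_bound {G : Type u} {E : Type v} [Group G] [Finite G] [Group E]
    [Finite E] {π : E →* G} (h : IsStemExtension π) :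
    Nat.card E ≤ Nat.card G ^ (Nat.card G * Nat.card G ^ 2 + 1) * Nat.card G := by
  have hG : 0 < Nat.card G := Nat.card_pos
  have hidx : (Subgroup.center E).index ≤ Nat.card G := by
    have h1 : (Subgroup.center E).index ≤ π.ker.index :=
      Nat.le_of_dvd (Nat.pos_of_ne_zero Subgroup.index_ne_zero_of_finite)
        (Subgroup.index_dvd_of_le h.ker_le_center)
    rw [Subgroup.index_ker, MonoidHom.range_eq_top.2 h.surjective] at h1
    simpa using h1
  have hset : Nat.card (commutatorSet E) ≤ Nat.card G ^ 2 := by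
    let s := Function.surjInv h.surjective
    have hs : ∀ x, π (s x) = x := Function.surjInv_eq h.surjective
    have hc : ∀ x : E, ∃ z ∈ Subgroup.center E, x = s (π x) * z := fun x =>
      ⟨(s (π x))⁻¹ * x, h.ker_le_center (by simp [MonoidHom.mem_ker, hs]), by simp⟩
    have hsurj : Function.Surjective (fun p : G × G =>
        (⟨s p.1 * s p.2 * (s p.1)⁻¹ * (s p.2)⁻¹, s p.1, s p.2, rfl⟩ : commutatorSet E)) := by
      rintro ⟨_, x, y, rfl⟩
      refine ⟨(π x, π y), Subtype.ext ?_⟩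
      obtain ⟨z, hz, hxz⟩ := hc x
      obtain ⟨w, hw, hyw⟩ := hc y
      rw [Subgroup.mem_center_iff] at hz hw
      change s (π x) * s (π y) * (s (π x))⁻¹ * (s (π y))⁻¹ = x * y * x⁻¹ * y⁻¹
      generalize s (π x) = a at *
      generalize s (π y) = b at *
      subst hxz hyw
      simp only [mul_inv_rev]
      have e1 : a * z * (b * w) = a * b * (w * z) := by
        rw [mul_assoc a z, ← hz (b * w)]; group
      have e2 : z⁻¹ * a⁻¹ * (w⁻¹ * b⁻¹) = (w * z)⁻¹ * (a⁻¹ * b⁻¹) := by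
        have h3 : z⁻¹ * a⁻¹ * w⁻¹ = w⁻¹ * (z⁻¹ * a⁻¹) := by
          have := congrArg (·⁻¹) (hw (a * z))
          simp only [mul_inv_rev] at this
          rw [this]
        have h4 : w⁻¹ * z⁻¹ = z⁻¹ * w⁻¹ := by
          have := congrArg (·⁻¹) (hw z)
          simp only [mul_inv_rev] at this
          exact this
        rw [← mul_assoc, h3, mul_inv_rev, ← h4]; group
      calc a * b * a⁻¹ * b⁻¹ = a * b * (w * z) * ((w * z)⁻¹ * (a⁻¹ * b⁻¹)) := by group
        _ = a * z * (b * w) * (z⁻¹ * a⁻¹ * (w⁻¹ * b⁻¹)) := by rw [e1, e2]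
        _ = _ := by group
    have := Nat.card_le_card_of_surjective _ hsurj
    rwa [Nat.card_prod, ← sq] at this
  have hcomm : Nat.card (commutator E) ≤ Nat.card G ^ (Nat.card G * Nat.card G ^ 2 + 1) := by
    have hi : 0 < (Subgroup.center E).index := Nat.pos_of_ne_zero Subgroup.index_ne_zero_of_finite
    refine (Nat.le_of_dvd (Nat.pow_pos hi) (Subgroup.card_commutator_dvd_index_center_pow E)).trans ?_
    exact (Nat.pow_le_pow_left hidx _).trans (Nat.pow_le_pow_right hG
      (Nat.add_le_add_right (Nat.mul_le_mul hidx hset) 1))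
  have hker : Nat.card π.ker ≤ Nat.card (commutator E) :=
    Nat.card_le_card_of_injective _ (Subgroup.inclusion_injective h.ker_le_commutator)
  have hprod : Nat.card π.ker * Nat.card G = Nat.card E := by
    rw [← Subgroup.card_mul_index π.ker, Subgroup.index_ker,
      MonoidHom.range_eq_top.2 h.surjective]
    simp
  rw [← hprod]
  exact Nat.mul_le_mul_right _ (hker.trans hcomm)

/-- Every finite group has a Schur cover. -/
theorem exists_isSchurCover (G : Type u) [Group G] [Finite G] :
    ∃ (E : Type v) (_ : Group E) (π : E →* G), IsSchurCover π := by
  classical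
  let P : ℕ → Prop := fun m => ∃ (E : Type v) (_ : Group E) (_ : Finite E) (π : E →* G),
    IsStemExtension π ∧ Nat.card E = m
  have hbd : ∃ B, ∀ m, P m → m ≤ B := ⟨_, by
    rintro m ⟨E, _, _, π, h, rfl⟩
    exact h.card_bound⟩
  have hne : ∃ m, P m := by
    let f : Shrink.{v} G →* G := (Shrink.mulEquiv.{v} (α := G)).toMonoidHom
    have hk : f.ker = ⊥ := (MonoidHom.ker_eq_bot_iff f).2 (Shrink.mulEquiv.{v} (α := G)).injective
    exact ⟨_, Shrink.{v} G, inferInstance, inferInstance, f,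
      ⟨(Shrink.mulEquiv.{v} (α := G)).surjective, hk ▸ bot_le, hk ▸ bot_le⟩, rfl⟩
  obtain ⟨B, hB⟩ := hbd
  obtain ⟨m₀, hm₀⟩ := hne
  obtain ⟨E, i, hf, π, hπ, hE⟩ : P (Nat.findGreatest P B) :=
    Nat.findGreatest_spec (hB _ hm₀) hm₀
  exact ⟨E, i, π, hf, hπ, fun H _ _ ρ hρ => hE ▸
    Nat.le_findGreatest (hB _ ⟨H, _, ‹_›, ρ, hρ, rfl⟩) ⟨H, _, ‹_›, ρ, hρ, rfl⟩⟩

/-! ### Deep commutation and commutators of lifts. -/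

section DeepCommute

open scoped commutatorElement

variable {G : Type u} {E : Type v} [Group G] [Group E]

/-! The commutator of lifts of two commuting elements is central and depends only on the elements.
It is trivial when their orders are coprime (`DeepCommute.of_coprime`), or when one is conjugated to
a suitable power by something centralizing the other (`DeepCommute.of_conj`). The second criterion
covers disjoint 3-cycles, and a cycle of prime length at least 5 together with anything disjoint
from it.

Call a cycle of prime length `p ≥ n - 2` long. Its centralizer in `A_n` is the cyclic group it
generates, so the nontrivial elements of that group form a whole component. Every other nontrivial
element is linked to a 3-cycle: pass to a power of prime order and treat the primes 2, 3 and at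
least 5 separately (`exists_isThreeCycle_deepLinked`). All 3-cycles are linked, so these elements
form one further component.

Hence `longPrimeSubgroup` is a complete invariant of components (`deepLinked_iff`). There are `(p -
1)! * n.choose p` cycles of length `p`, with `p - 1` in each subgroup, so `p` contributes `(p - 2)!
* n.choose p` components. -/

/-- `x` and `y` commute deeply with respect to `π : E →* G`: all their preimages commute. -/
def DeepCommute (π : E →* G) (x y : G) : Prop :=
  ∀ a b : E, π a = x → π b = y → Commute a b

theorem commutatorElement_zpow_left {a b : E} (h : ⁅a, b⁆ ∈ Subgroup.center E) (k : ℤ) :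
    ⁅a ^ k, b⁆ = ⁅a, b⁆ ^ k := by
  have hc : Commute ⁅a, b⁆ (b * a * b⁻¹) := ((Subgroup.mem_center_iff.1 h) _).symm
  have h1 : a = ⁅a, b⁆ * (b * a * b⁻¹) := by rw [commutatorElement_def]; group
  have h2 : a ^ k = ⁅a, b⁆ ^ k * (b * a ^ k * b⁻¹) := by
    conv_lhs => rw [h1, hc.mul_zpow, conj_zpow]
  calc ⁅a ^ k, b⁆ = a ^ k * (b * a ^ k * b⁻¹)⁻¹ := by rw [commutatorElement_def]; group
    _ = _ := mul_inv_eq_of_eq_mul h2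

/-- This makes the commutator of two lifts independent of the lifts when the kernel is central. -/
theorem commutatorElement_mul_center (a b : E) {z w : E} (hz : z ∈ Subgroup.center E)
    (hw : w ∈ Subgroup.center E) : ⁅a * z, b * w⁆ = ⁅a, b⁆ := by
  have hz' : ∀ c, Commute z c := fun c => ((Subgroup.mem_center_iff.1 hz) c).symm
  have hw' : ∀ c, Commute w c := fun c => ((Subgroup.mem_center_iff.1 hw) c).symm
  have e1 : a * z * (b * w) * (a * z)⁻¹ = a * (b * w) * a⁻¹ := by
    rw [mul_assoc a z, (hz' (b * w)).eq]; group
  have e2 : a * (b * w) * a⁻¹ = a * b * a⁻¹ * w := by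
    rw [mul_assoc, mul_assoc, mul_assoc, (hw' a⁻¹).eq]; group
  rw [commutatorElement_def, commutatorElement_def, e1, e2]; group

variable {π : E →* G}

namespace DeepCommute

theorem symm {x y : G} (h : DeepCommute π x y) : DeepCommute π y x :=
  fun a b ha hb => (h b a hb ha).symm

theorem commute (hs : Function.Surjective π) {x y : G} (h : DeepCommute π x y) :
    Commute x y := by
  obtain ⟨a, rfl⟩ := hs x
  obtain ⟨b, rfl⟩ := hs y
  exact (h a b rfl rfl).map π

theorem of_lift (hz : π.ker ≤ Subgroup.center E) {a b : E} (h : Commute a b) :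
    DeepCommute π (π a) (π b) := by
  intro a' b' ha hb
  have h1 : a⁻¹ * a' ∈ Subgroup.center E := hz (by simp [MonoidHom.mem_ker, ha])
  have h2 : b⁻¹ * b' ∈ Subgroup.center E := hz (by simp [MonoidHom.mem_ker, hb])
  rw [← commutatorElement_eq_one_iff_commute]
  have := commutatorElement_mul_center a b h1 h2
  rw [mul_inv_cancel_left, mul_inv_cancel_left] at this
  rw [this, commutatorElement_eq_one_iff_commute]
  exact h

theorem self_zpow (hs : Function.Surjective π) (hz : π.ker ≤ Subgroup.center E) (x : G) (k : ℤ) :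
    DeepCommute π x (x ^ k) := by
  obtain ⟨a, rfl⟩ := hs x
  rw [← map_zpow]
  exact of_lift hz ((Commute.refl a).zpow_right k)

theorem refl (hs : Function.Surjective π) (hz : π.ker ≤ Subgroup.center E) (x : G) :
    DeepCommute π x x := by
  simpa using self_zpow hs hz x 1

theorem mul_right (hs : Function.Surjective π) (hz : π.ker ≤ Subgroup.center E) {x y z : G}
    (hy : DeepCommute π x y) (hz' : DeepCommute π x z) : DeepCommute π x (y * z) := by
  obtain ⟨a, rfl⟩ := hs x
  obtain ⟨b, rfl⟩ := hs y
  obtain ⟨c, rfl⟩ := hs z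
  rw [← map_mul]
  exact of_lift hz ((hy a b rfl rfl).mul_right (hz' a c rfl rfl))

/-- Commuting elements commute deeply if the first one is conjugate, by an element centralizing the
second one, to its `k`-th power with `k - 1` prime to its order. -/
theorem of_conj (hs : Function.Surjective π) (hz : π.ker ≤ Subgroup.center E) {x y g : G}
    (hxy : Commute x y) {m k : ℤ} (hx : x ^ m = 1) (hg : g * x * g⁻¹ = x ^ k) (hgy : Commute g y)
    (hk : IsCoprime (k - 1) m) : DeepCommute π x y := by
  obtain ⟨a, rfl⟩ := hs x
  obtain ⟨b, rfl⟩ := hs y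
  obtain ⟨t, rfl⟩ := hs g
  have hc : ⁅a, b⁆ ∈ Subgroup.center E := hz (by
    rw [MonoidHom.mem_ker, map_commutatorElement, commutatorElement_eq_one_iff_commute]
    exact hxy)
  refine of_lift hz (commutatorElement_eq_one_iff_commute.1 ?_)
  have h1 : ⁅a, b⁆ ^ m = 1 := by
    rw [← commutatorElement_zpow_left hc, commutatorElement_eq_one_iff_commute]
    exact ((Subgroup.mem_center_iff.1 (hz (by simpa [MonoidHom.mem_ker] using hx))) b).symm
  have h2 : (a ^ k)⁻¹ * (t * a * t⁻¹) ∈ Subgroup.center E :=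
    hz (by simp [MonoidHom.mem_ker, hg])
  have h3 : b⁻¹ * (t * b * t⁻¹) ∈ Subgroup.center E :=
    hz (by simp [MonoidHom.mem_ker, hgy.eq])
  -- Conjugation by `t` fixes the central commutator, yet it carries `a` to `a ^ k` and `b` to `b`
  -- up to central factors.
  have h4 : ⁅a, b⁆ ^ k = ⁅a, b⁆ := by
    have := commutatorElement_mul_center (a ^ k) b h2 h3
    rw [mul_inv_cancel_left, mul_inv_cancel_left, commutatorElement_zpow_left hc] at this
    rw [← this, ← conjugate_commutatorElement, (Subgroup.mem_center_iff.1 hc t)]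
    group
  have h5 : ⁅a, b⁆ ^ (k - 1) = 1 := by rw [zpow_sub_one, h4, mul_inv_cancel]
  obtain ⟨u, w, huw⟩ := hk
  rw [← zpow_one ⁅a, b⁆, ← huw, zpow_add, mul_comm u, mul_comm w, zpow_mul, zpow_mul, h5, h1]
  simp

/-- The order of the commutator of lifts divides both `m` and `k`. -/
theorem of_coprime (hs : Function.Surjective π) (hz : π.ker ≤ Subgroup.center E) {x y : G}
    (hxy : Commute x y) {m k : ℕ} (hx : x ^ m = 1) (hy : y ^ k = 1) (h : m.Coprime k) :
    DeepCommute π x y := by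
  obtain ⟨a, rfl⟩ := hs x
  obtain ⟨b, rfl⟩ := hs y
  have hc : ⁅a, b⁆ ∈ Subgroup.center E := hz (by
    rw [MonoidHom.mem_ker, map_commutatorElement, commutatorElement_eq_one_iff_commute]
    exact hxy)
  have hc' : ⁅b, a⁆ ∈ Subgroup.center E := by
    rw [← commutatorElement_inv]; exact inv_mem hc
  refine of_lift hz (commutatorElement_eq_one_iff_commute.1 ?_)
  have h1 : ⁅a, b⁆ ^ m = 1 := by
    rw [← zpow_natCast, ← commutatorElement_zpow_left hc, commutatorElement_eq_one_iff_commute]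
    exact ((Subgroup.mem_center_iff.1 (hz (by simpa [MonoidHom.mem_ker] using hx))) b).symm
  have h2 : ⁅b, a⁆ ^ k = 1 := by
    rw [← zpow_natCast, ← commutatorElement_zpow_left hc', commutatorElement_eq_one_iff_commute]
    exact ((Subgroup.mem_center_iff.1 (hz (by simpa [MonoidHom.mem_ker] using hy))) a).symm
  rw [← commutatorElement_inv, inv_pow, inv_eq_one] at h2
  rw [← orderOf_eq_one_iff]
  exact Nat.eq_one_of_dvd_coprimes h (orderOf_dvd_of_pow_eq_one h1) (orderOf_dvd_of_pow_eq_one h2)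

end DeepCommute

/-- The elements commuting deeply with `x`. -/
def deepCentralizer (hs : Function.Surjective π) (hz : π.ker ≤ Subgroup.center E) (x : G) :
    Subgroup G where
  carrier := {y | DeepCommute π x y}
  one_mem' := by simpa using DeepCommute.self_zpow hs hz x 0
  mul_mem' := DeepCommute.mul_right hs hz
  inv_mem' := by
    intro y hy
    obtain ⟨a, rfl⟩ := hs x
    obtain ⟨b, rfl⟩ := hs y
    have := DeepCommute.of_lift hz (hy a b rfl rfl).inv_right
    rwa [map_inv] at this

end DeepCommute

/-! ### Centralizers and conjugation of cycles. -/

section Perm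

open Equiv Equiv.Perm

variable {α : Type*} [Fintype α] [DecidableEq α]

/-- Write `x` as `(a b)(b c)`; conjugating by `(a b)` reverses the two factors. -/
theorem Equiv.Perm.IsThreeCycle.exists_swap_conj_eq_inv {x : Perm α} (hx : x.IsThreeCycle) :
    ∃ a ∈ x.support, ∃ b ∈ x.support, a ≠ b ∧ swap a b * x * swap a b = x⁻¹ := by
  obtain ⟨a, ha⟩ := hx.isCycle.nonempty_support
  have hnd := hx.nodup_iff_mem_support.2 ha
  have heq := hx.eq_swap_mul_swap_iff_mem_support.2 ha
  simp only [List.nodup_cons, List.mem_cons, List.not_mem_nil, or_false, not_or] at hnd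
  refine ⟨a, ha, x a, by simpa using ha, by tauto, ?_⟩
  generalize x a = b at *
  generalize x b = c at *
  rw [heq, mul_inv_rev, swap_inv, swap_inv]
  rw [← mul_assoc, swap_mul_self, one_mul]

/-- An even permutation commuting with an even cycle that moves all but at most two points is a
power of that cycle. -/
theorem Equiv.Perm.IsCycle.mem_zpowers_of_commute {x y : Perm α} (hx : x.IsCycle)
    (hcard : Fintype.card α ≤ x.support.card + 2) (hxs : Perm.sign x = 1) (hys : Perm.sign y = 1)
    (hxy : Commute x y) : y ∈ Subgroup.zpowers x := by
  obtain ⟨a, ha⟩ := hx.nonempty_support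
  rw [mem_support] at ha
  have hya : x (y a) ≠ y a := by
    rw [← Perm.mul_apply, hxy.eq, Perm.mul_apply]
    exact fun h => ha (y.injective h)
  obtain ⟨k, hk⟩ := hx.exists_zpow_eq ha hya
  -- Dividing `y` by the power of `x` that agrees with it at `a` leaves an even permutation fixing
  -- the support of `x`. It moves at most two points, so it is trivial.
  set r := x ^ (-k) * y with hr
  have hra : r a = a := by
    rw [hr, Perm.mul_apply, ← hk, ← Perm.mul_apply, ← zpow_add]; simp
  have hrx : Commute r x := ((Commute.refl x).zpow_left _).mul_left hxy.symm
  have hfix : ∀ b ∈ x.support, r b = b := by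
    intro b hb
    obtain ⟨j, rfl⟩ := hx.exists_zpow_eq ha (mem_support.1 hb)
    rw [← Perm.mul_apply, (hrx.zpow_right j).eq, Perm.mul_apply, hra]
  have hsub : r.support ⊆ x.supportᶜ := by
    intro b hb
    rw [Finset.mem_compl]
    exact fun h => (mem_support.1 hb) (hfix b h)
  have hle : r.support.card ≤ 2 := by
    have := Finset.card_le_card hsub
    rw [Finset.card_compl] at this
    omega
  have hrs : Perm.sign r = 1 := by rw [hr, map_mul, map_zpow, hxs, hys]; simp
  have hr1 : r = 1 := by
    rcases Nat.lt_or_ge r.support.card 2 with h | h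
    · exact card_support_le_one.1 (by omega)
    · have := (card_support_eq_two.1 (le_antisymm hle h)).sign_eq
      rw [hrs] at this
      exact absurd this (by decide)
  refine ⟨k, ?_⟩
  have : x ^ (-k) * y = 1 := hr1
  rw [zpow_neg, inv_mul_eq_one] at this
  exact this

/-- A conjugation of a cycle into a power of itself can be done inside its support. -/
theorem Equiv.Perm.IsCycle.exists_conj_eq_of_support_eq {x z : Perm α} (hx : x.IsCycle)
    (hz : z.IsCycle) (hsupp : x.support = z.support) :
    ∃ t : Perm α, t * x * t⁻¹ = z ∧ ∀ b ∉ x.support, t b = b := by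
  obtain ⟨t, ht⟩ := _root_.isConj_iff.1 (hx.isConj hz (by rw [hsupp]))
  have hmem : ∀ b, b ∈ x.support ↔ t b ∈ x.support := by
    intro b
    have h1 := congrArg Perm.support ht
    rw [support_conj, ← hsupp] at h1
    conv_rhs => rw [← h1]
    simp
  refine ⟨ofSubtype (t.subtypePerm (p := (· ∈ x.support)) fun b => (hmem b).symm), ?_, ?_⟩
  · rw [mul_inv_eq_iff_eq_mul] at ht ⊢
    ext b
    by_cases hb : b ∈ x.support
    · have hxb : x b ∈ x.support := by simpa using hb
      rw [Perm.mul_apply, Perm.mul_apply, ofSubtype_apply_of_mem _ hb,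
        ofSubtype_apply_of_mem _ hxb]
      simpa using congrArg (fun f : Perm α => f b) ht
    · have hxb : x b = b := notMem_support.1 hb
      have hzb : z b = b := notMem_support.1 (hsupp ▸ hb)
      rw [Perm.mul_apply, Perm.mul_apply, hxb, ofSubtype_apply_of_not_mem _ hb, hzb]
  · intro b hb
    exact ofSubtype_apply_of_not_mem _ hb

theorem exists_isThreeCycle_support_disjoint (s : Finset α) (hs : s.card + 3 ≤ Fintype.card α) :
    ∃ t : Perm α, t.IsThreeCycle ∧ Disjoint t.support s := by
  obtain ⟨u, hu, hu3⟩ := Finset.exists_subset_card_eq (s := sᶜ) (n := 3)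
    (by rw [Finset.card_compl]; omega)
  obtain ⟨a, b, c, hab, hac, hbc, rfl⟩ := Finset.card_eq_three.1 hu3
  have h3 := isThreeCycle_swap_mul_swap_same hab hac hbc
  refine ⟨_, h3, ?_⟩
  have hsub : (swap a b * swap a c).support ⊆ {a, b, c} := by
    refine (support_mul_le _ _).trans ?_
    rw [support_swap hab, support_swap hac]
    intro z; simp
  exact Finset.disjoint_of_subset_left (hsub.trans hu) (Finset.disjoint_left.2 fun z hz =>
    Finset.mem_compl.1 hz)

end Perm

/-! ### Linking elements of order two or three to 3-cycles. -/

section Alternating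

open Equiv Equiv.Perm

variable {α : Type u} [Fintype α] [DecidableEq α] {E : Type v} [Group E]
  {π : E →* alternatingGroup α}

theorem alternatingGroup_commute_iff {x y : alternatingGroup α} :
    Commute x y ↔ Commute (x : Perm α) (y : Perm α) :=
  ⟨fun h => h.map (alternatingGroup α).subtype, fun h => Subtype.ext h⟩

/-- If `x` moves `a`, a 3-cycle that fixes `a` but moves `x a` does not commute with `x`. -/
theorem alternatingGroup_eq_one_of_forall_commute (hα : 4 ≤ Fintype.card α)
    {x : alternatingGroup α} (h : ∀ y, Commute x y) : x = 1 := by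
  by_contra hx
  obtain ⟨a, ha⟩ : ∃ a, (x : Perm α) a ≠ a := by
    by_contra! h'
    exact hx (Subtype.ext (Perm.ext h'))
  obtain ⟨u, hu, hu2⟩ := Finset.exists_subset_card_eq (s := ({a, (x : Perm α) a} : Finset α)ᶜ)
    (n := 2) (by rw [Finset.card_compl, Finset.card_pair ha.symm]; omega)
  obtain ⟨c, d, hcd, rfl⟩ := Finset.card_eq_two.1 hu2
  have hc : c ≠ a ∧ c ≠ (x : Perm α) a := by simpa using hu (by simp : c ∈ _)
  have hd : d ≠ a ∧ d ≠ (x : Perm α) a := by simpa using hu (by simp : d ∈ _)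
  have h3 := isThreeCycle_swap_mul_swap_same hc.2.symm hd.2.symm hcd
  have := alternatingGroup_commute_iff.1 (h ⟨_, h3.mem_alternatingGroup⟩)
  have h1 := congrArg (fun f : Perm α => f a) this.eq
  simp only [Perm.mul_apply] at h1
  rw [swap_apply_of_ne_of_ne ha.symm hd.1.symm, swap_apply_of_ne_of_ne ha.symm hc.1.symm,
    swap_apply_left, swap_apply_of_ne_of_ne hd.2 hcd.symm] at h1
  exact hd.2 h1.symm

theorem mem_universalVerts_deepCommutingGraph_iff (hα : 4 ≤ Fintype.card α)
    (hs : Function.Surjective π) (hz : π.ker ≤ Subgroup.center E) {x : alternatingGroup α} :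
    x ∈ (deepCommutingGraph π).universalVerts ↔ x = 1 := by
  constructor
  · intro h
    refine alternatingGroup_eq_one_of_forall_commute hα fun y => ?_
    by_cases hxy : x = y
    · rw [hxy]
    · exact DeepCommute.commute hs (h hxy).2
  · rintro rfl y hy
    refine ⟨hy, DeepCommute.symm ?_⟩
    simpa using DeepCommute.self_zpow hs hz y 0

/-- `x` and `y` are vertices of the reduced deep commuting graph in the same component. -/
def DeepLinked (π : E →* alternatingGroup α) (x y : alternatingGroup α) : Prop :=
  ∃ hx hy, (reducedGraph (deepCommutingGraph π)).Reachable ⟨x, hx⟩ ⟨y, hy⟩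

theorem DeepLinked.symm {x y : alternatingGroup α} (h : DeepLinked π x y) : DeepLinked π y x :=
  let ⟨hx, hy, h⟩ := h
  ⟨hy, hx, h.symm⟩

theorem DeepLinked.trans {x y z : alternatingGroup α} (h : DeepLinked π x y)
    (h' : DeepLinked π y z) : DeepLinked π x z :=
  let ⟨hx, _, h⟩ := h
  let ⟨_, hz, h'⟩ := h'
  ⟨hx, hz, h.trans h'⟩

theorem DeepCommute.linked (hα : 8 ≤ Fintype.card α) (hs : Function.Surjective π)
    (hz : π.ker ≤ Subgroup.center E) {x y : alternatingGroup α} (hx : x ≠ 1) (hy : y ≠ 1)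
    (h : DeepCommute π x y) : DeepLinked π x y := by
  have H := fun v => not_congr (mem_universalVerts_deepCommutingGraph_iff (by omega) hs hz (x := v))
  refine ⟨(H x).2 hx, (H y).2 hy, ?_⟩
  by_cases hxy : x = y
  · subst hxy; rfl
  · exact SimpleGraph.Adj.reachable ⟨hxy, h⟩

/-- Eight points leave two, `c` and `d`, outside both supports. Then `(a b)(c d)` is even, inverts
`x` and centralizes `y`, so `DeepCommute.of_conj` applies with `k = -1`, as -2 is prime to 3. -/
theorem DeepCommute.of_disjoint_isThreeCycle (hα : 8 ≤ Fintype.card α)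
    (hs : Function.Surjective π) (hz : π.ker ≤ Subgroup.center E) {x y : alternatingGroup α}
    (hx : (x : Perm α).IsThreeCycle) (hy : (y : Perm α).IsThreeCycle)
    (hxy : (x : Perm α).Disjoint y) : DeepCommute π x y := by
  obtain ⟨a, ha, b, hb, hab, hinv⟩ := hx.exists_swap_conj_eq_inv
  obtain ⟨u, hu, hu2⟩ := Finset.exists_subset_card_eq
    (s := ((x : Perm α).support ∪ (y : Perm α).support)ᶜ) (n := 2) (by
      rw [Finset.card_compl]
      have := Finset.card_union_le (x : Perm α).support (y : Perm α).support
      rw [hx.card_support, hy.card_support] at this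
      omega)
  obtain ⟨c, d, hcd, rfl⟩ := Finset.card_eq_two.1 hu2
  have hc : c ∉ (x : Perm α).support ∧ c ∉ (y : Perm α).support := by
    simpa only [Finset.mem_compl, Finset.mem_union, not_or] using hu (by simp : c ∈ _)
  have hd : d ∉ (x : Perm α).support ∧ d ∉ (y : Perm α).support := by
    simpa only [Finset.mem_compl, Finset.mem_union, not_or] using hu (by simp : d ∈ _)
  have hdis : ∀ {s t : α} {w : Perm α}, s ∉ w.support → t ∉ w.support →
      Commute (swap s t) w := by
    intro s t w hs ht
    refine (disjoint_iff_disjoint_support.2 ?_).commute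
    refine Finset.disjoint_left.2 fun z hz => ?_
    have : z = s ∨ z = t := by
      by_contra! h
      exact (mem_support.1 hz) (swap_apply_of_ne_of_ne h.1 h.2)
    rcases this with rfl | rfl <;> assumption
  have hxy' := Finset.disjoint_left.1 (disjoint_iff_disjoint_support.1 hxy)
  let g : alternatingGroup α := ⟨swap a b * swap c d, by
    rw [mem_alternatingGroup, map_mul, sign_swap hab, sign_swap hcd]; rfl⟩
  refine DeepCommute.of_conj hs hz (alternatingGroup_commute_iff.2 hxy.commute) (m := 3) (k := -1)
    (g := g) ?_ ?_ ?_ ⟨1, 1, by norm_num⟩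
  · refine Subtype.ext ?_
    have := pow_orderOf_eq_one (x : Perm α)
    rw [hx.orderOf] at this
    exact_mod_cast this
  · refine Subtype.ext ?_
    have h1 : swap c d * (x : Perm α) * swap c d = x := by
      rw [(hdis hc.1 hd.1).eq, mul_assoc, swap_mul_self, mul_one]
    change swap a b * swap c d * (x : Perm α) * (swap a b * swap c d)⁻¹ = _
    rw [mul_inv_rev, swap_inv, swap_inv]
    calc _ = swap a b * (swap c d * (x : Perm α) * swap c d) * swap a b := by simp only [mul_assoc]
      _ = _ := by rw [h1, hinv]; simp
  · exact alternatingGroup_commute_iff.2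
      ((hdis (hxy' ha) (hxy' hb)).mul_left (hdis hc.2 hd.2))

/-- Intersecting supports cover at most five points, which leaves room for a third 3-cycle disjoint
from both. -/
theorem deepLinked_of_isThreeCycle (hα : 8 ≤ Fintype.card α)
    (hs : Function.Surjective π) (hz : π.ker ≤ Subgroup.center E) {x y : alternatingGroup α}
    (hx : (x : Perm α).IsThreeCycle) (hy : (y : Perm α).IsThreeCycle) : DeepLinked π x y := by
  have hne : ∀ {w : alternatingGroup α}, (w : Perm α).IsThreeCycle → w ≠ 1 :=
    fun hw h => hw.ne_one (by rw [h]; rfl)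
  have key : ∀ {x y : alternatingGroup α}, (x : Perm α).IsThreeCycle → (y : Perm α).IsThreeCycle →
      ((x : Perm α).support ∪ (y : Perm α).support).card ≤ 5 → DeepLinked π x y := by
    intro x y hx hy hcard
    obtain ⟨t, ht, hdis⟩ := exists_isThreeCycle_support_disjoint 
      ((x : Perm α).support ∪ (y : Perm α).support) (by omega)
    rw [Finset.disjoint_union_right] at hdis
    let t' : alternatingGroup α := ⟨t, ht.mem_alternatingGroup⟩
    exact (DeepCommute.of_disjoint_isThreeCycle (y := t') hα hs hz hx ht
      (disjoint_iff_disjoint_support.2 hdis.1.symm)).linked hα hs hz (hne hx) (hne ht) |>.trans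
      ((DeepCommute.of_disjoint_isThreeCycle (x := t') hα hs hz ht hy
      (disjoint_iff_disjoint_support.2 hdis.2)).linked hα hs hz (hne ht) (hne hy))
  by_cases hd : (x : Perm α).Disjoint y
  · exact (DeepCommute.of_disjoint_isThreeCycle hα hs hz hx hy hd).linked hα hs hz (hne hx) (hne hy)
  · refine key hx hy ?_
    have h1 := Finset.card_union_add_card_inter (x : Perm α).support (y : Perm α).support
    rw [hx.card_support, hy.card_support] at h1
    rw [disjoint_iff_disjoint_support, Finset.disjoint_iff_inter_eq_empty,
      ← Finset.card_eq_zero] at hd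
    omega

/-- An element of order prime to three with at least three fixed points is linked to a
three-cycle. -/
theorem exists_isThreeCycle_deepLinked_of_coprime (hα : 8 ≤ Fintype.card α)
    (hs : Function.Surjective π) (hz : π.ker ≤ Subgroup.center E) {x : alternatingGroup α}
    (hx : x ≠ 1) {m : ℕ} (hm : x ^ m = 1) (hm3 : m.Coprime 3)
    (hcard : (x : Perm α).support.card + 3 ≤ Fintype.card α) :
    ∃ t : alternatingGroup α, (t : Perm α).IsThreeCycle ∧ DeepLinked π x t := by
  obtain ⟨t, ht, hdis⟩ := exists_isThreeCycle_support_disjoint _ hcard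
  let t' : alternatingGroup α := ⟨t, ht.mem_alternatingGroup⟩
  refine ⟨t', ht, (DeepCommute.of_coprime hs hz ?_ hm (k := 3) ?_ hm3).linked hα hs hz hx ?_⟩
  · exact alternatingGroup_commute_iff.2 (disjoint_iff_disjoint_support.2 hdis).commute.symm
  · refine Subtype.ext ?_
    have := pow_orderOf_eq_one t
    rwa [ht.orderOf] at this
  · exact fun h => ht.ne_one (congrArg Subtype.val h)

/-- An involution with few fixed points has three transpositions. Taking one point from each gives a
3-cycle `s` that `x` exchanges with a disjoint 3-cycle `t`. So `x` commutes with `s * t`, whose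
order is prime to 2, and `s * t` commutes deeply with `s`. -/
theorem exists_isThreeCycle_deepLinked_of_sq_eq_one (hα : 8 ≤ Fintype.card α)
    (hs : Function.Surjective π) (hz : π.ker ≤ Subgroup.center E) {x : alternatingGroup α}
    (hx : x ≠ 1) (hx2 : x ^ 2 = 1) :
    ∃ t : alternatingGroup α, (t : Perm α).IsThreeCycle ∧ DeepLinked π x t := by
  by_cases hcard : (x : Perm α).support.card + 3 ≤ Fintype.card α
  · exact exists_isThreeCycle_deepLinked_of_coprime hα hs hz hx hx2 (by norm_num) hcard
  set g : Perm α := (x : Perm α) with hg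
  have hgg : ∀ c, g (g c) = c := by
    intro c
    have h2 : g ^ 2 = 1 := congrArg Subtype.val hx2
    rw [← Perm.mul_apply, ← sq, h2, Perm.one_apply]
  -- At most two points are fixed, so at least six are moved.
  have hpick : ∀ s : Finset α, s.card ≤ 4 → ∃ c ∈ g.support, c ∉ s := by
    intro s hs
    by_contra! h
    have := Finset.card_le_card (show g.support ⊆ s from h)
    omega
  obtain ⟨a, ha, -⟩ := hpick ∅ (by simp)
  obtain ⟨b, hb, hbs⟩ := hpick {a, g a} (Finset.card_le_two.trans (by norm_num))
  obtain ⟨c, hc, hcs⟩ := hpick {a, g a, b, g b} Finset.card_le_four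
  simp only [Finset.mem_insert, Finset.mem_singleton, not_or] at hbs hcs
  rw [mem_support] at ha hb hc
  have hab : a ≠ b := fun h => hbs.1 h.symm
  have hac : a ≠ c := fun h => hcs.1 h.symm
  have hbc : b ≠ c := fun h => hcs.2.2.1 h.symm
  have h3 := isThreeCycle_swap_mul_swap_same hab hac hbc
  have h3' := isThreeCycle_swap_mul_swap_same (g.injective.ne hab) (g.injective.ne hac)
    (g.injective.ne hbc)
  have hsub : ∀ p q r : α, (swap p q * swap p r).support ⊆ {p, q, r} := by
    intro p q r z hz
    by_contra h
    simp only [Finset.mem_insert, Finset.mem_singleton, not_or] at h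
    refine (mem_support.1 hz) ?_
    rw [Perm.mul_apply, swap_apply_of_ne_of_ne h.1 h.2.2, swap_apply_of_ne_of_ne h.1 h.2.1]
  have hdis : (swap a b * swap a c).Disjoint (swap (g a) (g b) * swap (g a) (g c)) := by
    rw [disjoint_iff_disjoint_support]
    refine Finset.disjoint_of_subset_left (hsub _ _ _)
      (Finset.disjoint_of_subset_right (hsub _ _ _) ?_)
    have hga : g b ≠ a := fun h => hbs.2 (by rw [← h, hgg])
    have hgca : g c ≠ a := fun h => hcs.2.1 (by rw [← h, hgg])
    have hgcb : g c ≠ b := fun h => hcs.2.2.2 (by rw [← h, hgg])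
    simp only [Finset.disjoint_insert_left, Finset.disjoint_singleton_left, Finset.mem_insert,
      Finset.mem_singleton, not_or]
    refine ⟨⟨ha.symm, hga.symm, hgca.symm⟩, ⟨hbs.2, hb.symm, hgcb.symm⟩, hcs.2.1, hcs.2.2.2,
      hc.symm⟩
  set s : alternatingGroup α := ⟨_, h3.mem_alternatingGroup⟩ with hsdef
  set t : alternatingGroup α := ⟨_, h3'.mem_alternatingGroup⟩ with htdef
  have hst : Commute s t := alternatingGroup_commute_iff.2 hdis.commute
  have hconj : ∀ p q, g * swap p q * g⁻¹ = swap (g p) (g q) := by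
    intro p q
    rw [mul_swap_eq_swap_mul, mul_inv_cancel_right]
  have hxs : x * s * x⁻¹ = t := by
    refine Subtype.ext ?_
    change g * (swap a b * swap a c) * g⁻¹ = _
    rw [← conj_mul, hconj, hconj]
  have hxt : x * t * x⁻¹ = s := by
    refine Subtype.ext ?_
    change g * (swap (g a) (g b) * swap (g a) (g c)) * g⁻¹ = _
    rw [← conj_mul, hconj, hconj, hgg, hgg, hgg]
  have hcube : ∀ {w : alternatingGroup α}, (w : Perm α).IsThreeCycle → w ^ 3 = 1 := by
    intro w hw
    refine Subtype.ext ?_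
    have := pow_orderOf_eq_one (w : Perm α)
    rwa [hw.orderOf] at this
  have hs1 : s ≠ 1 := fun h => h3.ne_one (congrArg Subtype.val h)
  have hst1 : s * t ≠ 1 := by
    intro h
    have h' := hdis.mul_eq_one_iff.1 (congrArg Subtype.val h)
    exact h3.ne_one h'.1
  refine ⟨s, h3, DeepLinked.trans (y := s * t) ?_ ?_⟩
  · refine (DeepCommute.of_coprime hs hz ?_ hx2 (k := 3) ?_ (by norm_num)).linked hα hs hz hx hst1
    · have : x * (s * t) * x⁻¹ = s * t := by rw [← conj_mul, hxs, hxt, hst.eq]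
      exact mul_inv_eq_iff_eq_mul.1 this
    · rw [hst.mul_pow, hcube h3, hcube h3', one_mul]
  · refine (DeepCommute.linked hα hs hz hs1 hst1 ?_).symm
    exact (DeepCommute.refl hs hz s).mul_right hs hz
      (DeepCommute.of_disjoint_isThreeCycle hα hs hz h3 h3' hdis)

theorem exists_isThreeCycle_deepLinked_of_cube_eq_one (hα : 8 ≤ Fintype.card α)
    (hs : Function.Surjective π) (hz : π.ker ≤ Subgroup.center E) {x : alternatingGroup α}
    (hx : x ≠ 1) (hx3 : x ^ 3 = 1) :
    ∃ t : alternatingGroup α, (t : Perm α).IsThreeCycle ∧ DeepLinked π x t := by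
  have hthree : ∀ c ∈ (x : Perm α).cycleFactorsFinset, c.IsThreeCycle := by
    intro c hc
    have h1 : c.support.card ∈ (x : Perm α).cycleType := by
      rw [cycleType_def]
      exact Multiset.mem_map_of_mem _ hc
    have h2 := (dvd_of_mem_cycleType h1).trans
      (orderOf_dvd_of_pow_eq_one (congrArg Subtype.val hx3 : (x : Perm α) ^ 3 = 1))
    have h3 := two_le_of_mem_cycleType h1
    rcases (Nat.dvd_prime Nat.prime_three).1 h2 with h | h
    · omega
    · exact card_support_eq_three_iff.1 h
  obtain ⟨c, hc⟩ : (x : Perm α).cycleFactorsFinset.Nonempty := by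
    rw [Finset.nonempty_iff_ne_empty, Ne, cycleFactorsFinset_eq_empty_iff]
    exact fun h => hx (Subtype.ext h)
  let t : alternatingGroup α := ⟨c, (hthree c hc).mem_alternatingGroup⟩
  refine ⟨t, hthree c hc, (DeepCommute.symm ?_).linked hα hs hz hx
    fun h => (hthree c hc).ne_one (congrArg Subtype.val h)⟩
  -- All cycles of `x` are 3-cycles commuting deeply with `c`; their product does too, since the
  -- deep centralizer is a subgroup.
  have hmem : (x : Perm α) ∈ (deepCentralizer hs hz t).map (alternatingGroup α).subtype := by
    rw [← cycleFactorsFinset_noncommProd (x : Perm α)]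
    refine Subgroup.noncommProd_mem _ _ fun d hd => ?_
    refine ⟨⟨d, (hthree d hd).mem_alternatingGroup⟩, ?_, rfl⟩
    by_cases hcd : c = d
    · subst hcd
      exact DeepCommute.refl hs hz _
    · exact DeepCommute.of_disjoint_isThreeCycle hα hs hz (hthree c hc) (hthree d hd)
        (cycleFactorsFinset_pairwise_disjoint _ hc hd hcd)
  obtain ⟨y, hy, hyx⟩ := hmem
  rwa [← (Subtype.ext hyx : y = x)]

/-- Some `t` supported on the cycle conjugates `x` to `x ^ 2`. It may be odd, so `t * t` is used: it
is even and conjugates `x` to `x ^ 4`, and 4 - 1 = 3 is prime to the length. -/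
theorem DeepCommute.of_disjoint_isCycle (hs : Function.Surjective π)
    (hz : π.ker ≤ Subgroup.center E) {x y : alternatingGroup α} (hx : (x : Perm α).IsCycle)
    (hp : (x : Perm α).support.card.Prime) (h5 : 5 ≤ (x : Perm α).support.card)
    (hxy : (x : Perm α).Disjoint y) : DeepCommute π x y := by
  have hord := hx.orderOf
  have h2 := hx.isCycle_pow_pos_of_lt_prime_order (hord ▸ hp) 2 two_pos (by omega)
  have hsupp := hx.support_pow_of_pos_of_lt_orderOf two_pos (by omega)
  obtain ⟨t, ht, htf⟩ := hx.exists_conj_eq_of_support_eq h2 hsupp.symm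
  have hty : t.Disjoint y := by
    intro b
    by_cases hb : b ∈ (x : Perm α).support
    · exact Or.inr ((hxy b).resolve_left (mem_support.1 hb))
    · exact Or.inl (htf b hb)
  let g : alternatingGroup α := ⟨t * t, by rw [mem_alternatingGroup, map_mul, Int.units_mul_self]⟩
  refine DeepCommute.of_conj hs hz (alternatingGroup_commute_iff.2 hxy.commute)
    (m := (x : Perm α).support.card) (k := 4) (g := g) ?_ ?_ ?_ ?_
  · refine Subtype.ext ?_
    have := pow_orderOf_eq_one (x : Perm α)
    rw [hord] at this
    rw [zpow_natCast]
    exact this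
  · refine Subtype.ext ?_
    change t * t * (x : Perm α) * (t * t)⁻¹ = (x : Perm α) ^ (4 : ℤ)
    calc _ = t * (t * (x : Perm α) * t⁻¹) * t⁻¹ := by group
      _ = _ := by rw [ht, ← conj_pow, ht, ← pow_mul]; norm_cast
  · exact alternatingGroup_commute_iff.2 (hty.commute.mul_left hty.commute)
  · norm_num
    have : Nat.Coprime 3 (x : Perm α).support.card :=
      (Nat.coprime_primes Nat.prime_three hp).2 (by omega)
    exact_mod_cast Nat.isCoprime_iff_coprime.2 this

end Alternating

/-! ### Long prime cycles and the component invariant. -/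

section Count

open Equiv Equiv.Perm

/-- A cycle of prime length fixing at most two points. -/
def Equiv.Perm.IsLongPrimeCycle {α : Type*} [Fintype α] [DecidableEq α] (x : Perm α) : Prop :=
  x.IsCycle ∧ x.support.card.Prime ∧ Fintype.card α ≤ x.support.card + 2

variable {α : Type u} [Fintype α] [DecidableEq α] {E : Type v} [Group E]
  {π : E →* alternatingGroup α}

theorem alternatingGroup_mem_zpowers_iff {x y : alternatingGroup α} :
    y ∈ Subgroup.zpowers x ↔ (y : Perm α) ∈ Subgroup.zpowers (x : Perm α) := by
  simp only [Subgroup.mem_zpowers_iff, Subtype.ext_iff, Subgroup.coe_zpow]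

theorem Equiv.Perm.IsLongPrimeCycle.mem_zpowers_of_commute {x y : alternatingGroup α}
    (hx : (x : Perm α).IsLongPrimeCycle) (hxy : Commute x y) : y ∈ Subgroup.zpowers x :=
  alternatingGroup_mem_zpowers_iff.2 (hx.1.mem_zpowers_of_commute hx.2.2
    (mem_alternatingGroup.1 x.2) (mem_alternatingGroup.1 y.2) (alternatingGroup_commute_iff.1 hxy))

theorem support_eq_of_zpowers_eq {x y : alternatingGroup α}
    (h : Subgroup.zpowers y = Subgroup.zpowers x) :
    (y : Perm α).support = (x : Perm α).support := by
  have key : ∀ {x y : alternatingGroup α}, y ∈ Subgroup.zpowers x →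
      (y : Perm α).support ⊆ (x : Perm α).support := by
    rintro x _ ⟨k, rfl⟩
    exact support_zpow_le _ _
  exact (key (h ▸ Subgroup.mem_zpowers y)).antisymm (key (h ▸ Subgroup.mem_zpowers x))

theorem Equiv.Perm.IsLongPrimeCycle.orderOf_eq {x : alternatingGroup α}
    (hx : (x : Perm α).IsLongPrimeCycle) : orderOf x = (x : Perm α).support.card := by
  rw [← Subgroup.orderOf_coe, hx.1.orderOf]

theorem Equiv.Perm.IsLongPrimeCycle.zpowers_eq {x y : alternatingGroup α}
    (hx : (x : Perm α).IsLongPrimeCycle) (hy : y ∈ Subgroup.zpowers x) (hy1 : y ≠ 1) :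
    Subgroup.zpowers y = Subgroup.zpowers x := by
  refine Subgroup.eq_of_le_of_card_ge (Subgroup.zpowers_le.2 hy) ?_
  have h1 : orderOf y ∣ (x : Perm α).support.card := hx.orderOf_eq ▸ orderOf_dvd_of_mem_zpowers hy
  rw [Nat.card_zpowers, Nat.card_zpowers, hx.orderOf_eq]
  rcases (Nat.dvd_prime hx.2.1).1 h1 with h | h
  · exact absurd (orderOf_eq_one_iff.1 h) hy1
  · exact h.ge

theorem Equiv.Perm.IsLongPrimeCycle.of_zpowers_eq {x y : alternatingGroup α}
    (hx : (x : Perm α).IsLongPrimeCycle) (h : Subgroup.zpowers y = Subgroup.zpowers x) :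
    (y : Perm α).IsLongPrimeCycle := by
  have hsupp := support_eq_of_zpowers_eq h
  rw [IsLongPrimeCycle, hsupp]
  refine ⟨?_, hx.2⟩
  obtain ⟨k, hk⟩ : x ∈ Subgroup.zpowers y := h ▸ Subgroup.mem_zpowers x
  have hk' : (y : Perm α) ^ k = x := congrArg Subtype.val hk
  exact IsCycle.of_zpow (n := k) (hk' ▸ hx.1) (by rw [hk', hsupp])

theorem Equiv.Perm.IsLongPrimeCycle.zpowers_eq_of_commute {x y : alternatingGroup α}
    (hx : (x : Perm α).IsLongPrimeCycle) (hy1 : y ≠ 1) (hxy : Commute x y) :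
    Subgroup.zpowers y = Subgroup.zpowers x :=
  hx.zpowers_eq (hx.mem_zpowers_of_commute hxy) hy1

/-- A cycle `c` of `x` has length `orderOf x` and commutes deeply with itself and with the rest of
`x`, hence with `x`. If `c` were long, `x` would generate the same group and be long too; so `c`
leaves room for a disjoint 3-cycle of coprime order. -/
theorem exists_isThreeCycle_deepLinked_of_prime_orderOf (hα : 8 ≤ Fintype.card α)
    (hs : Function.Surjective π) (hz : π.ker ≤ Subgroup.center E) {x : alternatingGroup α}
    (hp : (orderOf x).Prime) (h5 : 5 ≤ orderOf x) (hx : ¬ (x : Perm α).IsLongPrimeCycle) :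
    ∃ t : alternatingGroup α, (t : Perm α).IsThreeCycle ∧ DeepLinked π x t := by
  have hx1 : x ≠ 1 := by
    rintro rfl
    simp at h5
  obtain ⟨c, hc⟩ : (x : Perm α).cycleFactorsFinset.Nonempty := by
    rw [Finset.nonempty_iff_ne_empty, Ne, cycleFactorsFinset_eq_empty_iff]
    exact fun h => hx1 (Subtype.ext h)
  have hcyc : c.IsCycle := (mem_cycleFactorsFinset_iff.1 hc).1
  have hcard : c.support.card = orderOf x := by
    have h1 : c.support.card ∈ (x : Perm α).cycleType := by
      rw [cycleType_def]
      exact Multiset.mem_map_of_mem _ hc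
    have h2 := dvd_of_mem_cycleType h1
    have h3 := two_le_of_mem_cycleType h1
    rw [Subgroup.orderOf_coe] at h2
    exact ((Nat.dvd_prime hp).1 h2).resolve_left (by omega)
  have hsign : Perm.sign c = 1 := by
    rw [hcyc.sign, hcard, (hp.odd_of_ne_two (by omega)).neg_one_pow, neg_neg]
  set c' : alternatingGroup α := ⟨c, hsign⟩ with hc'
  have hc1 : c' ≠ 1 := fun h => hcyc.ne_one (congrArg Subtype.val h)
  have hdeep : DeepCommute π c' x := by
    have h1 : DeepCommute π c' (x * c'⁻¹) :=
      DeepCommute.of_disjoint_isCycle hs hz hcyc (hcard ▸ hp) (hcard ▸ h5)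
        (disjoint_mul_inv_of_mem_cycleFactorsFinset hc).symm
    simpa using h1.mul_right hs hz (DeepCommute.refl hs hz c')
  have hsmall : c.support.card + 3 ≤ Fintype.card α := by
    by_contra h
    have hlong : (c' : Perm α).IsLongPrimeCycle := 
      ⟨hcyc, hcard ▸ hp, by change _ ≤ c.support.card + 2; omega⟩
    exact hx (hlong.of_zpowers_eq (hlong.zpowers_eq_of_commute hx1 (hdeep.commute hs)))
  obtain ⟨t, ht, htl⟩ := exists_isThreeCycle_deepLinked_of_coprime (x := c') hα hs hz hc1
    (m := orderOf x) (Subtype.ext (by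
      have := pow_orderOf_eq_one c
      rwa [hcyc.orderOf, hcard] at this))
    ((Nat.coprime_primes hp Nat.prime_three).2 (by omega)) hsmall
  exact ⟨t, ht, (hdeep.symm.linked hα hs hz hx1 hc1).trans htl⟩

theorem exists_isThreeCycle_deepLinked (hα : 8 ≤ Fintype.card α)
    (hs : Function.Surjective π) (hz : π.ker ≤ Subgroup.center E) {x : alternatingGroup α}
    (hx1 : x ≠ 1) (hx : ¬ (x : Perm α).IsLongPrimeCycle) :
    ∃ t : alternatingGroup α, (t : Perm α).IsThreeCycle ∧ DeepLinked π x t := by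
  set p := (orderOf x).minFac with hpdef
  have hp : p.Prime := Nat.minFac_prime (fun h => hx1 (orderOf_eq_one_iff.1 h))
  set h := x ^ (orderOf x / p) with hh
  have hord : orderOf h = p := orderOf_pow_orderOf_div (orderOf_pos x).ne' (Nat.minFac_dvd _)
  have hh1 : h ≠ 1 := fun e => hp.one_lt.ne' (by rw [← hord, e, orderOf_one])
  have hdeep : DeepCommute π x h := by
    rw [hh, ← zpow_natCast]
    exact DeepCommute.self_zpow hs hz x _
  have hlink := hdeep.linked hα hs hz hx1 hh1
  -- Were `h` long, `x` would lie in its centralizer, the group generated by `h`, and would be long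
  -- itself.
  have hhlong : ¬ (h : Perm α).IsLongPrimeCycle := fun hl =>
    hx (hl.of_zpowers_eq (hl.zpowers_eq_of_commute hx1 (hdeep.commute hs).symm))
  obtain ⟨t, ht, htl⟩ : ∃ t : alternatingGroup α, (t : Perm α).IsThreeCycle ∧ DeepLinked π h t := by
    have hpow : h ^ p = 1 := hord ▸ pow_orderOf_eq_one h
    by_cases hp5 : 5 ≤ p
    · exact exists_isThreeCycle_deepLinked_of_prime_orderOf hα hs hz (hord ▸ hp) (hord ▸ hp5) hhlong
    · have := hp.two_le
      have h4 : p ≠ 4 := fun e => absurd (e ▸ hp) (by norm_num)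
      obtain e | e : p = 2 ∨ p = 3 := by omega
      · exact exists_isThreeCycle_deepLinked_of_sq_eq_one hα hs hz hh1 (e ▸ hpow)
      · exact exists_isThreeCycle_deepLinked_of_cube_eq_one hα hs hz hh1 (e ▸ hpow)
  exact ⟨t, ht, hlink.trans htl⟩

open Classical in
/-- The cyclic group generated by a long prime cycle; trivial for all other permutations. -/
noncomputable def longPrimeSubgroup (x : alternatingGroup α) : Subgroup (alternatingGroup α) :=
  if (x : Perm α).IsLongPrimeCycle then Subgroup.zpowers x else ⊥

/-- Invariance along edges: ordinary commutation already forces it. -/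
theorem longPrimeSubgroup_eq_of_commute {x y : alternatingGroup α} (hx : x ≠ 1) (hy : y ≠ 1)
    (hxy : Commute x y) : longPrimeSubgroup x = longPrimeSubgroup y := by
  by_cases hlx : (x : Perm α).IsLongPrimeCycle
  · have h := hlx.zpowers_eq_of_commute hy hxy
    rw [longPrimeSubgroup, longPrimeSubgroup, if_pos hlx, if_pos (hlx.of_zpowers_eq h), h]
  · have hly : ¬ (y : Perm α).IsLongPrimeCycle := fun hly =>
      hlx (hly.of_zpowers_eq (hly.zpowers_eq_of_commute hx hxy.symm))
    rw [longPrimeSubgroup, longPrimeSubgroup, if_neg hlx, if_neg hly]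

theorem deepLinked_iff (hα : 8 ≤ Fintype.card α)
    (hs : Function.Surjective π) (hz : π.ker ≤ Subgroup.center E) {x y : alternatingGroup α}
    (hx : x ≠ 1) (hy : y ≠ 1) :
    DeepLinked π x y ↔ longPrimeSubgroup x = longPrimeSubgroup y := by
  have H := fun v => not_congr (mem_universalVerts_deepCommutingGraph_iff (by omega) hs hz (x := v))
  constructor
  · rintro ⟨hx', hy', ⟨p⟩⟩
    have key : ∀ {a b} (_ : (reducedGraph (deepCommutingGraph π)).Walk a b),
        longPrimeSubgroup a.1 = longPrimeSubgroup b.1 := by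
      intro a b p
      induction p with
      | nil => rfl
      | @cons a b _ h _ ih =>
        exact (longPrimeSubgroup_eq_of_commute ((H a.1).1 a.2) ((H b.1).1 b.2)
          (DeepCommute.commute hs h.2)).trans ih
    exact key p
  · intro h
    have hbot : ∀ {w : alternatingGroup α}, w ≠ 1 → Subgroup.zpowers w ≠ ⊥ :=
      fun hw h => hw (Subgroup.zpowers_eq_bot.1 h)
    unfold longPrimeSubgroup at h
    split_ifs at h with hlx hly hly
    · obtain ⟨k, hk⟩ : y ∈ Subgroup.zpowers x := h ▸ Subgroup.mem_zpowers y
      refine DeepCommute.linked hα hs hz hx hy ?_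
      rw [← hk]
      exact DeepCommute.self_zpow hs hz x k
    · exact absurd h (hbot hx)
    · exact absurd h.symm (hbot hy)
    · obtain ⟨t, ht, hxt⟩ := exists_isThreeCycle_deepLinked hα hs hz hx hlx
      obtain ⟨s, hs', hys⟩ := exists_isThreeCycle_deepLinked hα hs hz hy hly
      exact hxt.trans ((deepLinked_of_isThreeCycle hα hs hz ht hs').trans hys.symm)

end Count

/-! ### Counting the values of the invariant. -/

section Count

open Equiv Equiv.Perm

variable {α : Type u} [Fintype α] [DecidableEq α] {E : Type v} [Group E]
  {π : E →* alternatingGroup α}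

theorem cycleType_eq_singleton_iff {x : Perm α} {p : ℕ} :
    x.cycleType = {p} ↔ x.IsCycle ∧ x.support.card = p := by
  constructor
  · intro h
    exact ⟨card_cycleType_eq_one.1 (by rw [h, Multiset.card_singleton]),
      by rw [← sum_cycleType, h, Multiset.sum_singleton]⟩
  · rintro ⟨h, rfl⟩
    exact h.cycleType

/-- The lengths of the long prime cycles. -/
def longPrimes (n : ℕ) : Finset ℕ := (Finset.Icc (n - 2) n).filter Nat.Prime

theorem isLongPrimeCycle_iff {x : Perm α} :
    x.IsLongPrimeCycle ↔ ∃ p ∈ longPrimes (Fintype.card α), x.cycleType = {p} := by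
  simp only [cycleType_eq_singleton_iff, longPrimes, Finset.mem_filter, Finset.mem_Icc,
    IsLongPrimeCycle]
  constructor
  · rintro ⟨h1, h2, h3⟩
    exact ⟨_, ⟨⟨by omega, Finset.card_le_univ _⟩, h2⟩, h1, rfl⟩
  · rintro ⟨p, ⟨⟨h1, h2⟩, h3⟩, h4, rfl⟩
    exact ⟨h4, h3, by omega⟩

open Classical in
theorem card_image_zpowers_cycleType (hα : 8 ≤ Fintype.card α) {p : ℕ}
    (hp : p ∈ longPrimes (Fintype.card α)) :
    (Finset.image Subgroup.zpowers
      {x : alternatingGroup α | (x : Perm α).cycleType = {p}}).card =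
      (p - 2).factorial * (Fintype.card α).choose p := by
  have hp' := hp
  simp only [longPrimes, Finset.mem_filter, Finset.mem_Icc] at hp'
  obtain ⟨⟨hl, hu⟩, hprime⟩ := hp'
  have hcount := AlternatingGroup.card_of_cycleType_singleton (α := α) hprime.two_le hu
  -- Here `p ≥ 6`, so `p` is odd and all `p`-cycles are even.
  rw [if_pos (hprime.odd_of_ne_two (by omega))] at hcount
  have hfib := Finset.card_eq_sum_card_image (Subgroup.zpowers (G := alternatingGroup α))
    {x : alternatingGroup α | (x : Perm α).cycleType = {p}}
  rw [Finset.sum_const_nat (m := p - 1), hcount] at hfib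
  · obtain ⟨q, rfl⟩ : ∃ q, p = q + 2 := ⟨p - 2, by omega⟩
    have e1 : q + 2 - 1 = q + 1 := rfl
    have e2 : q + 2 - 2 = q := rfl
    rw [e1, Nat.factorial_succ] at hfib
    rw [e2]
    refine Nat.eq_of_mul_eq_mul_right (Nat.succ_pos q) (hfib.symm.trans ?_)
    rw [Nat.succ_eq_add_one]
    ring
  · intro K hK
    obtain ⟨x, hx, rfl⟩ := Finset.mem_image.1 hK
    have hx' : (x : Perm α).cycleType = {p} := by simpa using hx
    have hlong : (x : Perm α).IsLongPrimeCycle := isLongPrimeCycle_iff.2 ⟨p, hp, hx'⟩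
    have hcard : Nat.card (Subgroup.zpowers x) = p := by
      rw [Nat.card_zpowers, hlong.orderOf_eq, (cycleType_eq_singleton_iff.1 hx').2]
    -- The fibre over a subgroup of order `p` is its set of `p - 1` nontrivial elements.
    have heq : Finset.filter (fun y => Subgroup.zpowers y = Subgroup.zpowers x)
        {x : alternatingGroup α | (x : Perm α).cycleType = {p}} =
        (Finset.univ.filter (· ∈ Subgroup.zpowers x)).erase 1 := by
      ext y
      simp only [Finset.mem_filter, Finset.mem_univ, true_and, Finset.mem_erase]
      constructor
      · rintro ⟨h1, h2⟩
        refine ⟨?_, h2 ▸ Subgroup.mem_zpowers y⟩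
        rintro rfl
        simp at h1
      · rintro ⟨h1, h2⟩
        have h3 := hlong.zpowers_eq h2 h1
        refine ⟨cycleType_eq_singleton_iff.2 ⟨(hlong.of_zpowers_eq h3).1, ?_⟩, h3⟩
        rw [support_eq_of_zpowers_eq h3, (cycleType_eq_singleton_iff.1 hx').2]
    rw [heq, Finset.card_erase_of_mem (by simp [one_mem]), ← hcard, Nat.card_eq_fintype_card,
      Fintype.card_subtype]

theorem image_longPrimeSubgroup (hα : 8 ≤ Fintype.card α)
    [DecidableEq (Subgroup (alternatingGroup α))] :
    longPrimeSubgroup '' {x : alternatingGroup α | x ≠ 1} =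
      (insert ⊥ ((longPrimes (Fintype.card α)).biUnion fun p => Finset.image Subgroup.zpowers
        {x : alternatingGroup α | (x : Perm α).cycleType = {p}}) : Finset _) := by
  ext K
  simp only [Set.mem_image, Set.mem_ofPred_eq, Finset.coe_insert, Set.mem_insert_iff,
    Finset.mem_coe, Finset.mem_biUnion, Finset.mem_image, Finset.mem_filter, Finset.mem_univ,
    true_and]
  constructor
  · rintro ⟨x, -, rfl⟩
    unfold longPrimeSubgroup
    split_ifs with h
    · obtain ⟨p, hp, hx⟩ := isLongPrimeCycle_iff.1 h
      exact Or.inr ⟨p, hp, x, hx, rfl⟩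
    · exact Or.inl rfl
  · rintro (rfl | ⟨p, hp, x, hx, rfl⟩)
    -- The value `⊥` is attained at a 3-cycle, which is not long on eight or more points.
    · obtain ⟨t, ht, -⟩ := exists_isThreeCycle_support_disjoint (∅ : Finset α)
        (by rw [Finset.card_empty]; omega)
      refine ⟨⟨t, ht.mem_alternatingGroup⟩, fun h => ht.ne_one (congrArg Subtype.val h), ?_⟩
      refine if_neg fun h => ?_
      have := h.2.2
      rw [ht.card_support] at this
      omega
    · have hlong := isLongPrimeCycle_iff.2 ⟨p, hp, hx⟩
      exact ⟨x, fun h => hlong.1.ne_one (congrArg Subtype.val h), if_pos hlong⟩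

/-- The number of components of the reduced deep commuting graph of an alternating group, computed
in an arbitrary central extension. -/
theorem card_connectedComponent_reducedGraph (hα : 8 ≤ Fintype.card α)
    (hs : Function.Surjective π) (hz : π.ker ≤ Subgroup.center E) :
    Nat.card (reducedGraph (deepCommutingGraph π)).ConnectedComponent =
      (∑ p ∈ longPrimes (Fintype.card α), (p - 2).factorial * (Fintype.card α).choose p) + 1 := by
  classical
  have H := fun v => not_congr (mem_universalVerts_deepCommutingGraph_iff (by omega) hs hz (x := v))
  have hlink : ∀ v w, (reducedGraph (deepCommutingGraph π)).Reachable v w ↔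
      longPrimeSubgroup v.1 = longPrimeSubgroup w.1 := fun v w => by
    rw [← deepLinked_iff hα hs hz ((H v.1).1 v.2) ((H w.1).1 w.2)]
    exact ⟨fun h => ⟨v.2, w.2, h⟩, fun ⟨_, _, h⟩ => h⟩
  let f : (reducedGraph (deepCommutingGraph π)).ConnectedComponent →
      Subgroup (alternatingGroup α) :=
    SimpleGraph.ConnectedComponent.lift (fun v => longPrimeSubgroup v.1)
      fun v w p _ => (hlink v w).1 p.reachable
  have hinj : Function.Injective f := by
    intro C D
    induction C using SimpleGraph.ConnectedComponent.ind
    induction D using SimpleGraph.ConnectedComponent.ind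
    exact fun h => SimpleGraph.ConnectedComponent.eq.2 ((hlink _ _).2 h)
  have hrange : Set.range f = longPrimeSubgroup '' {x : alternatingGroup α | x ≠ 1} := by
    ext K
    constructor
    · rintro ⟨C, rfl⟩
      induction C using SimpleGraph.ConnectedComponent.ind with
      | h v => exact ⟨v.1, (H v.1).1 v.2, rfl⟩
    · rintro ⟨x, hx, rfl⟩
      exact ⟨SimpleGraph.connectedComponentMk _ ⟨x, (H x).2 hx⟩, rfl⟩
  rw [← Nat.card_range_of_injective hinj, Nat.card_coe_set_eq, hrange, image_longPrimeSubgroup hα,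
    Set.ncard_coe_finset, Finset.card_insert_of_notMem, Finset.card_biUnion]
  · rw [Finset.sum_congr rfl fun p hp => card_image_zpowers_cycleType hα hp]
  -- The subgroup determines the support of its generators, hence the prime.
  · intro p _ q _ hpq
    refine Finset.disjoint_left.2 fun K hK hK' => hpq ?_
    obtain ⟨x, hx, rfl⟩ := Finset.mem_image.1 hK
    obtain ⟨y, hy, hyx⟩ := Finset.mem_image.1 hK'
    simp only [Finset.mem_filter, cycleType_eq_singleton_iff] at hx hy
    rw [← hx.2.2, ← hy.2.2, support_eq_of_zpowers_eq hyx]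
  · intro h
    simp only [Finset.mem_biUnion, Finset.mem_image, Finset.mem_filter] at h
    obtain ⟨p, _, x, ⟨_, hx⟩, hbot⟩ := h
    rw [Subgroup.zpowers_eq_bot] at hbot
    subst hbot
    simp at hx

end Count

/-! ### Evaluating the count for the three candidate primes. -/

theorem sum_longPrimes (n : ℕ) (hn : 2 ≤ n) (f : ℕ → ℕ) :
    ∑ p ∈ longPrimes n, f p = (if (n - 2).Prime then f (n - 2) else 0) +
      ((if (n - 1).Prime then f (n - 1) else 0) + if n.Prime then f n else 0) := by
  have h : Finset.Icc (n - 2) n = {n - 2, n - 1, n} := by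
    ext k
    simp only [Finset.mem_Icc, Finset.mem_insert, Finset.mem_singleton]
    omega
  rw [longPrimes, Finset.sum_filter, h, Finset.sum_insert, Finset.sum_insert, Finset.sum_singleton]
  · simp only [Finset.mem_singleton]; omega
  · simp only [Finset.mem_insert, Finset.mem_singleton]; omega

theorem SimpleGraph.connected_iff_natCard_connectedComponent {V : Type*} (Γ : SimpleGraph V) :
    Γ.Connected ↔ Nat.card Γ.ConnectedComponent = 1 := by
  rw [Nat.card_eq_one_iff_unique]
  constructor
  · intro h
    have := h.nonempty
    exact ⟨h.preconnected.subsingleton_connectedComponent,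
      ⟨Γ.connectedComponentMk (Classical.arbitrary V)⟩⟩
  · rintro ⟨h, ⟨C⟩⟩
    obtain ⟨v, -⟩ := C.exists_rep
    exact (SimpleGraph.connected_iff_exists_forall_reachable _).2
      ⟨v, fun w => SimpleGraph.ConnectedComponent.eq.1 (Subsingleton.elim _ _)⟩

theorem mainTheorem12 (n : ℕ) (hn : 8 ≤ n) {E : Type*} [Group E]
    (π : E →* alternatingGroup (Fin n)) (hπ : IsSchurCover π) :
    ((reducedGraph (deepCommutingGraph π)).Connected ↔
        ¬ n.Prime ∧ ¬ (n - 1).Prime ∧ ¬ (n - 2).Prime) ∧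
    (n.Prime ∧ ¬ (n - 1).Prime ∧ ¬ (n - 2).Prime →
      Nat.card (reducedGraph (deepCommutingGraph π)).ConnectedComponent = Nat.factorial (n - 2) + 1) ∧
    (¬ n.Prime ∧ (n - 1).Prime ∧ ¬ (n - 2).Prime →
      Nat.card (reducedGraph (deepCommutingGraph π)).ConnectedComponent = n * Nat.factorial (n - 3) + 1) ∧
    (¬ n.Prime ∧ ¬ (n - 1).Prime ∧ (n - 2).Prime →
      Nat.card (reducedGraph (deepCommutingGraph π)).ConnectedComponent =
        n * (n - 1) * Nat.factorial (n - 4) / 2 + 1) ∧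
    (n.Prime ∧ (n - 2).Prime →
      Nat.card (reducedGraph (deepCommutingGraph π)).ConnectedComponent =
        Nat.factorial (n - 2) + n * (n - 1) * Nat.factorial (n - 4) / 2 + 1) := by
  have hcard := card_connectedComponent_reducedGraph (π := π) (by simpa using hn)
    hπ.isStem.surjective hπ.isStem.ker_le_center
  rw [Fintype.card_fin, sum_longPrimes n (by omega)] at hcard
  have e1 : (n - 1 - 2).factorial * n.choose (n - 1) = n * (n - 3).factorial := by
    rw [Nat.choose_symm (by omega : 1 ≤ n), Nat.choose_one_right, mul_comm, Nat.sub_sub]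
  have e2 : (n - 2 - 2).factorial * n.choose (n - 2) = n * (n - 1) * (n - 4).factorial / 2 := by
    rw [Nat.choose_symm (by omega : 2 ≤ n), Nat.choose_two_right, mul_comm, Nat.sub_sub,
      Nat.div_mul_right_comm (Nat.even_mul_pred_self n).two_dvd]
  -- Positivity of all three contributions makes the count exceed 1 as soon as one candidate is
  -- prime.
  have p1 : 0 < n * (n - 3).factorial := Nat.mul_pos (by omega) (Nat.factorial_pos _)
  have p2 : 0 < n * (n - 1) * (n - 4).factorial / 2 := by
    rw [← e2]
    exact Nat.mul_pos (Nat.factorial_pos _) (Nat.choose_pos (Nat.sub_le _ _))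
  have p0 := Nat.factorial_pos (n - 2)
  rw [e1, e2, Nat.choose_self, mul_one] at hcard
  -- By parity, the middle term vanishes in case (iv).
  have hpar : n.Prime → ¬ (n - 1).Prime := by
    intro h h'
    have o1 := h.odd_of_ne_two (by omega)
    have o2 := h'.odd_of_ne_two (by omega)
    rw [Nat.odd_iff] at o1 o2
    omega
  rw [SimpleGraph.connected_iff_natCard_connectedComponent, hcard]
  refine ⟨⟨?_, ?_⟩, ?_, ?_, ?_, ?_⟩
  · intro h
    refine ⟨fun hp => ?_, fun hp => ?_, fun hp => ?_⟩ <;> rw [if_pos hp] at h <;> omega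
  · rintro ⟨h0, h1, h2⟩
    simp only [h0, h1, h2, if_false]
  · rintro ⟨h0, h1, h2⟩
    simp only [h0, h1, h2, if_false, if_true, zero_add]
  · rintro ⟨h0, h1, h2⟩
    simp only [h0, h1, h2, if_false, if_true, zero_add, add_zero]
  · rintro ⟨h0, h1, h2⟩
    simp only [h0, h1, h2, if_false, if_true, add_zero]
  · rintro ⟨h0, h2⟩
    simp only [h0, h2, hpar h0, if_false, if_true, zero_add]
    omega
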